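/- Let $M$ be a connected affine manifold of dimension $m$, i.e. a connected Hausdorff manifold with a maximal atlas whose transition functions are (locally) of the form $x\mapsto Ax+b$ with $A\in \mathrm{GL}(m,\mathbb{R})$, $b\in\mathbb{R}^m$. Let $\nabla$ be the associated flat torsion free connection, i.e. the connection on $TM$ whose Christoffel symbols vanish in all affine charts; thus a smooth curve $\gamma$ is a geodesic if and only if $(\varphi\circ\gamma)''=0$ for every affine chart $\varphi$. The manifold $M$ is called complete if every geodesic of $\nabla$, defined on a nonempty open interval, extends to a geodesic defined on all of $\mathbb{R}$. The following statements are equivalent: 1. $M$ is complete. 2. There are a discrete subgroup $\Gamma$ of the group $\mathsf{Aff}(\mathbb{R}^m)=\mathrm{GL}(m,\mathbb{R})\ltimes\mathbb{R}^m$ of affine transformations of $\mathbb{R}^m$, for which the projection $\mathbb{R}^m\to\mathbb{R}^m/\Gamma$ is a local homeomorphism, and an affine diffeomorphism $\Phi:\mathbb{R}^m/\Gamma\to M$, such that the composition $\pi:\mathbb{R}^m\to\mathbb{R}^m/\Gamma\xrightarrow{\Phi} M$ is the universal cover of $M$ (a surjective covering map with simply connected total space). Here the charts of $\mathbb{R}^m/\Gamma$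 are the local inverses of the projection $\mathbb{R}^m\to\mathbb{R}^m/\Gamma$. -/

import Mathlib

open Set Filter Topology
open scoped Manifold ContDiff

noncomputable section

/-- The space `ℝ^m`. -/
abbrev RSpace (m : ℕ) : Type := EuclideanSpace ℝ (Fin m)

/-- The group `Aff(ℝ^m)` of invertible affine transformations `x ↦ A x + b` of `ℝ^m`. -/
abbrev Aff (m : ℕ) : Type := RSpace m ≃ᵃ[ℝ] RSpace m

/-- The standard topology of `Aff(ℝ^m) = GL(m, ℝ) ⋉ ℝ^m`: the map `x ↦ A x + b` is identified with
the pair `(A, b)`. -/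
instance affTopologicalSpace (m : ℕ) : TopologicalSpace (Aff m) :=
  TopologicalSpace.induced
    (fun g : Aff m =>
      (LinearMap.toContinuousLinearMap (g.linear : RSpace m →ₗ[ℝ] RSpace m), g 0))
    inferInstance

/-- The tautological action of `Aff(ℝ^m)` on `ℝ^m`. -/
instance affMulAction (m : ℕ) : MulAction (Aff m) (RSpace m) where
  smul g x := g x
  one_smul _ := rfl
  mul_smul _ _ _ := rfl

/-- The pseudogroup of local homeomorphisms of `ℝ^m` which, together with their inverses, are near
each point of their domain of the form `x ↦ A x + b` with `A ∈ GL(m, ℝ)`. An affine manifold `M` is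
a Hausdorff space with an atlas modelled on `ℝ^m` whose transition functions belong to this
pseudogroup; its affine structure is the maximal atlas `(affineGroupoid m).maximalAtlas M`, whose
members are the affine charts. -/
def affineGroupoid (m : ℕ) : StructureGroupoid (RSpace m) :=
  Pregroupoid.groupoid
    { property := fun f u => ∀ x ∈ u, ∃ g : Aff m, ∀ᶠ y in 𝓝 x, f y = g y
      comp := by
        intro f g u v hf hg _ _ _ x hx
        obtain ⟨a, ha⟩ := hf x hx.1
        obtain ⟨b, hb⟩ := hg (f x) hx.2
        refine ⟨b * a, ?_⟩
        have hc : Tendsto f (𝓝 x) (𝓝 (f x)) := by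
          have h1 : Continuous a := a.toAffineMap.continuous_of_finiteDimensional
          have h2 : Tendsto a (𝓝 x) (𝓝 (f x)) := by
            rw [ha.self_of_nhds]
            exact h1.tendsto x
          exact h2.congr' (ha.mono fun y hy => hy.symm)
        filter_upwards [ha, hc.eventually hb] with y h1 h2
        change g (f y) = b (a y)
        rw [h2, h1]
      id_mem := fun _ _ => ⟨1, Eventually.of_forall fun _ => rfl⟩
      locality := by
        intro f u _ h x hx
        obtain ⟨v, _, hxv, hv⟩ := h x hx
        exact hv x ⟨hx, hxv⟩
      congr := by
        intro f g u hu hfg hf x hx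
        obtain ⟨a, ha⟩ := hf x hx
        refine ⟨a, ?_⟩
        filter_upwards [ha, hu.mem_nhds hx] with y h1 h2
        rw [hfg y h2, h1] }

/-- `γ` restricts to a geodesic on the open set `s ⊆ ℝ` of the flat torsion free connection `∇` of
the affine manifold `M`. In affine charts the Christoffel symbols of `∇` vanish, so that the
geodesic equation `∇_{γ'} γ' = 0` reads `(φ ∘ γ)'' = 0` for every affine chart `φ`. -/
structure IsGeodesicOn (m : ℕ) {M : Type*} [TopologicalSpace M] [ChartedSpace (RSpace m) M]
    (γ : ℝ → M) (s : Set ℝ) : Prop where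
  continuousOn : ContinuousOn γ s
  contDiffAt : ∀ φ ∈ (affineGroupoid m).maximalAtlas M, ∀ t ∈ s, γ t ∈ φ.source →
    ContDiffAt ℝ ∞ (φ ∘ γ) t
  geodesic_eq : ∀ φ ∈ (affineGroupoid m).maximalAtlas M, ∀ t ∈ s, γ t ∈ φ.source →
    deriv (deriv (φ ∘ γ)) t = 0

/-- An affine manifold is complete if every geodesic, defined on a nonempty open interval, extends
to a geodesic defined on all of `ℝ`. -/
def IsCompleteAffine (m : ℕ) (M : Type*) [TopologicalSpace M] [ChartedSpace (RSpace m) M] : Prop :=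
  ∀ (γ : ℝ → M) (s : Set ℝ), IsOpen s → s.OrdConnected → s.Nonempty → IsGeodesicOn m γ s →
    ∃ γ' : ℝ → M, IsGeodesicOn m γ' univ ∧ EqOn γ' γ s

/-- The quotient `ℝ^m / Γ`, with the quotient topology. -/
abbrev AffQuotient {m : ℕ} (Γ : Subgroup (Aff m)) : Type :=
  MulAction.orbitRel.Quotient Γ (RSpace m)

/-- The projection `ℝ^m → ℝ^m / Γ`. -/
def affProj {m : ℕ} (Γ : Subgroup (Aff m)) : RSpace m → AffQuotient Γ :=
  Quotient.mk (MulAction.orbitRel Γ (RSpace m))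

/-- If the projection `ℝ^m → ℝ^m / Γ` is a local homeomorphism, its local inverses are the charts
of `ℝ^m / Γ`. -/
abbrev affQuotientChartedSpace {m : ℕ} (Γ : Subgroup (Aff m))
    (hΓ : IsLocalHomeomorph (affProj Γ)) : ChartedSpace (RSpace m) (AffQuotient Γ) :=
  hΓ.chartedSpace Quotient.mk_surjective

/-- `p : X → Y` is a universal cover of `Y`: a surjective covering map with simply connected
total space. -/
structure IsUniversalCover {X Y : Type*} [TopologicalSpace X] [TopologicalSpace Y]
    (p : X → Y) : Prop where
  simplyConnected : SimplyConnectedSpace X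
  isCoveringMap : IsCoveringMap p
  surjective : Function.Surjective p

end

/-! Completeness yields an exponential map: `f x` is the value at time 1 of the geodesic that
starts, in a fixed chart, as the segment from `x₀` to `x`. It is affine étale everywhere
(`IsCompleteAffine.exists_exp`). Unique continuation (`AffineAt.eqOn`) extends an affine transition
between germs to all of `ℝ^m`, so two étale maps with a common value differ by an affine
transformation (`AffineEtaleAt.exists_comp_aff_eq`). Applied to `f` twice, this makes the fibres of
`f` the orbits of `Γ = affDeck f`, and `f` a covering; applied to exponential maps at different
points, it makes the image of `f` closed, hence all of `M`.

Conversely, a geodesic of `M` lifts locally to a straight line in `ℝ^m`, and the image of the whole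
line extends it. -/

/-- Near `x`, the map `f` is an affine map read in an affine chart of `M`. -/
def AffineAt (m : ℕ) {E M : Type*} [NormedAddCommGroup E] [NormedSpace ℝ E] [TopologicalSpace M]
    [ChartedSpace (RSpace m) M] (f : E → M) (x : E) : Prop :=
  ∃ φ ∈ (affineGroupoid m).maximalAtlas M, ∃ A : E →ᵃ[ℝ] RSpace m,
    A x ∈ φ.target ∧ f =ᶠ[𝓝 x] φ.symm ∘ A

/-- Near `x`, the map `f` is an affine isomorphism read in an affine chart of `M`. -/
def AffineEtaleAt (m : ℕ) {M : Type*} [TopologicalSpace M]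
    [ChartedSpace (RSpace m) M] (f : RSpace m → M) (x : RSpace m) : Prop :=
  ∃ φ ∈ (affineGroupoid m).maximalAtlas M, ∃ A : Aff m,
    A x ∈ φ.target ∧ f =ᶠ[𝓝 x] φ.symm ∘ A

/-! ### Locally affine maps, unique continuation, geodesics. -/

section Basic

variable {m : ℕ} {E F : Type*} [NormedAddCommGroup E] [NormedSpace ℝ E]
  [NormedAddCommGroup F] [NormedSpace ℝ F]

theorem Aff.continuous (A : Aff m) : Continuous A :=
  A.toAffineMap.continuous_of_finiteDimensional

/-- Affine maps that agree near one point are equal. -/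
theorem AffineMap.eq_of_eventuallyEq {A B : E →ᵃ[ℝ] F} {x : E} (h : A =ᶠ[𝓝 x] B) : A = B := by
  ext y
  have hc : Tendsto (fun t : ℝ => AffineMap.lineMap x y t) (𝓝 0) (𝓝 x) := by
    simpa using (AffineMap.lineMap_continuous (R := ℝ) (p := x) (q := y)).tendsto 0
  -- Both maps agree at a point of the line from `x` to `y` with small parameter `t ≠ 0`; dividing
  -- by `t` reaches `y`.
  obtain ⟨t, ht, ht0⟩ := (((hc.eventually h).filter_mono nhdsWithin_le_nhds).and
    (self_mem_nhdsWithin : {t : ℝ | t ≠ 0} ∈ 𝓝[≠] 0)).exists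
  have hx := h.self_of_nhds
  rw [AffineMap.apply_lineMap, AffineMap.apply_lineMap, hx, AffineMap.lineMap_apply_module',
    AffineMap.lineMap_apply_module'] at ht
  have := smul_right_injective F ht0 (add_right_cancel ht)
  simpa using this

/-- The condition on the inverse is automatic: the inverse of an affine germ is affine. -/
theorem mem_affineGroupoid_iff {e : OpenPartialHomeomorph (RSpace m) (RSpace m)} :
    e ∈ affineGroupoid m ↔ ∀ x ∈ e.source, ∃ g : Aff m, e =ᶠ[𝓝 x] g := by
  rw [affineGroupoid, mem_groupoid_of_pregroupoid]
  refine ⟨fun h => h.1, fun h => ⟨h, fun y hy => ?_⟩⟩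
  obtain ⟨g, hg⟩ := h (e.symm y) (e.map_target hy)
  refine ⟨g.symm, ?_⟩
  filter_upwards [(e.continuousAt_symm hy).eventually hg, e.open_target.mem_nhds hy] with z h1 h2
  rw [e.right_inv h2] at h1
  exact (g.symm_apply_eq.2 h1).symm

variable {M : Type*} [TopologicalSpace M] [ChartedSpace (RSpace m) M]

theorem exists_aff_transition {φ ψ : OpenPartialHomeomorph M (RSpace m)}
    (hφ : φ ∈ (affineGroupoid m).maximalAtlas M) (hψ : ψ ∈ (affineGroupoid m).maximalAtlas M)
    {z : RSpace m} (hz : z ∈ φ.target) (hz' : φ.symm z ∈ ψ.source) :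
    ∃ g : Aff m, ψ ∘ φ.symm =ᶠ[𝓝 z] g := by
  have h := mem_affineGroupoid_iff.1
    ((affineGroupoid m).compatible_of_mem_maximalAtlas hφ hψ) z (by simp [hz, hz'])
  simpa using h

namespace AffineEtaleAt

variable {f : RSpace m → M} {x : RSpace m}

theorem affineAt (h : AffineEtaleAt m f x) : AffineAt m f x := by
  obtain ⟨φ, hφ, A, hA, h⟩ := h
  exact ⟨φ, hφ, A.toAffineMap, hA, h⟩

theorem eventually (h : AffineEtaleAt m f x) : ∀ᶠ y in 𝓝 x, AffineEtaleAt m f y := by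
  obtain ⟨φ, hφ, A, hA, h⟩ := h
  filter_upwards [h.eventually_nhds, A.continuous.continuousAt.eventually
    (φ.open_target.mem_nhds hA)] with y h1 h2
  exact ⟨φ, hφ, A, h2, h1⟩

theorem comp_aff (g : Aff m) (h : AffineEtaleAt m f (g x)) : AffineEtaleAt m (f ∘ g) x := by
  obtain ⟨φ, hφ, A, hA, h⟩ := h
  exact ⟨φ, hφ, A * g, hA, g.continuous.continuousAt.eventually h⟩

end AffineEtaleAt

namespace AffineAt

variable {f : E → M} {x : E}

theorem continuousAt [FiniteDimensional ℝ E] (h : AffineAt m f x) : ContinuousAt f x := by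
  obtain ⟨φ, hφ, A, hA, h⟩ := h
  refine ContinuousAt.congr ?_ h.symm
  exact (φ.continuousAt_symm hA).comp A.continuous_of_finiteDimensional.continuousAt

theorem comp [FiniteDimensional ℝ F] {B : F →ᵃ[ℝ] E} {y : F} (h : AffineAt m f (B y)) :
    AffineAt m (f ∘ B) y := by
  obtain ⟨φ, hφ, A, hA, h⟩ := h
  exact ⟨φ, hφ, A.comp B, hA, B.continuous_of_finiteDimensional.continuousAt.eventually h⟩

theorem eventually_source [FiniteDimensional ℝ E] (h : AffineAt m f x) {ψ : OpenPartialHomeomorph M (RSpace m)}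
    (hx : f x ∈ ψ.source) : ∀ᶠ y in 𝓝 x, f y ∈ ψ.source :=
  h.continuousAt.eventually (ψ.open_source.mem_nhds hx)

theorem eventuallyEq_symm [FiniteDimensional ℝ E] (h : AffineAt m f x) {ψ : OpenPartialHomeomorph M (RSpace m)}
    (hx : f x ∈ ψ.source) {A : E → RSpace m} (hA : ψ ∘ f =ᶠ[𝓝 x] A) :
    f =ᶠ[𝓝 x] ψ.symm ∘ A := by
  filter_upwards [h.eventually_source hx, hA] with y h1 h2
  simp only [Function.comp_apply] at h2 ⊢
  rw [← h2, ψ.left_inv h1]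

theorem exists_chart_eq [FiniteDimensional ℝ E] (h : AffineAt m f x) {ψ : OpenPartialHomeomorph M (RSpace m)}
    (hψ : ψ ∈ (affineGroupoid m).maximalAtlas M) (hx : f x ∈ ψ.source) :
    ∃ A : E →ᵃ[ℝ] RSpace m, ψ ∘ f =ᶠ[𝓝 x] A := by
  obtain ⟨φ, hφ, A, hA, h⟩ := h
  rw [h.self_of_nhds] at hx
  obtain ⟨g, hg⟩ := exists_aff_transition hφ hψ hA hx
  refine ⟨g.toAffineMap.comp A, ?_⟩
  filter_upwards [h, A.continuous_of_finiteDimensional.continuousAt.eventually hg] with y h1 h2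
  simpa [h1] using h2

end AffineAt

theorem AffineEtaleAt.exists_chart_eq {f : RSpace m → M} {x : RSpace m} (h : AffineEtaleAt m f x)
    {ψ : OpenPartialHomeomorph M (RSpace m)}
    (hψ : ψ ∈ (affineGroupoid m).maximalAtlas M) (hx : f x ∈ ψ.source) :
    ∃ A : Aff m, ψ ∘ f =ᶠ[𝓝 x] A := by
  obtain ⟨φ, hφ, A, hA, h⟩ := h
  rw [h.self_of_nhds] at hx
  obtain ⟨g, hg⟩ := exists_aff_transition hφ hψ hA hx
  refine ⟨g * A, ?_⟩
  filter_upwards [h, A.continuous.continuousAt.eventually hg] with y h1 h2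
  simpa [h1] using h2

/-- Locally affine maps that agree near one point of a preconnected set agree on this set. -/
theorem AffineAt.eqOn [FiniteDimensional ℝ E] [T2Space M] [HasGroupoid M (affineGroupoid m)]
    {f g : E → M} {U : Set E}
    (hU : IsPreconnected U) (hf : ∀ x ∈ U, AffineAt m f x) (hg : ∀ x ∈ U, AffineAt m g x)
    {x₀ : E} (hx₀ : x₀ ∈ U) (h₀ : f =ᶠ[𝓝 x₀] g) : EqOn f g U := by
  -- Agreement of germs is an open condition. For closedness, Hausdorffness gives equal values at a
  -- limit point; in a chart there, both maps are affine and agree near some nearby point, so they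
  -- coincide.
  have hsub : U ⊆ {x | f =ᶠ[𝓝 x] g} := by
    refine hU.subset_of_closure_inter_subset isOpen_setOfPred_eventually_nhds ⟨x₀, hx₀, h₀⟩ ?_
    rintro x ⟨hxc, hxU⟩
    have hfr : ∃ᶠ y in 𝓝 x, f =ᶠ[𝓝 y] g := mem_closure_iff_frequently.1 hxc
    have hfx : f x = g x := by
      by_contra hne
      have := ((hf x hxU).continuousAt.prodMk (hg x hxU).continuousAt).eventually
        (isClosed_diagonal.isOpen_compl.mem_nhds (show (f x, g x) ∈ (diagonal M)ᶜ from hne))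
      obtain ⟨y, h1, h2⟩ := (hfr.and_eventually this).exists
      exact h2 h1.self_of_nhds
    have hφ := (affineGroupoid m).chart_mem_maximalAtlas (M := M) (f x)
    have hs : f x ∈ (chartAt (RSpace m) (f x)).source := mem_chart_source _ _
    generalize chartAt (RSpace m) (f x) = φ at hφ hs
    obtain ⟨A, hA⟩ := (hf x hxU).exists_chart_eq hφ hs
    obtain ⟨B, hB⟩ := (hg x hxU).exists_chart_eq hφ (hfx ▸ hs)
    obtain ⟨y, h1, h2, h3⟩ := (hfr.and_eventually (hA.eventually_nhds.and hB.eventually_nhds)).exists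
    have hAB : A = B := AffineMap.eq_of_eventuallyEq (x := y) <| by
      filter_upwards [h1, h2, h3] with z h1 h2 h3
      rw [← h2, ← h3, Function.comp_apply, Function.comp_apply, h1]
    subst hAB
    exact ((hf x hxU).eventuallyEq_symm hs hA).trans
      ((hg x hxU).eventuallyEq_symm (hfx ▸ hs) hB).symm
  exact fun x hx => (hsub hx).self_of_nhds

/-- A curve which is smooth near `t` with vanishing second derivative is affine near `t`. -/
theorem exists_affineMap_eq_of_deriv_deriv_eq_zero {c : ℝ → E} {t : ℝ}
    (h : ∀ᶠ s in 𝓝 t, ContDiffAt ℝ ∞ c s ∧ deriv (deriv c) s = 0) :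
    ∃ A : ℝ →ᵃ[ℝ] E, c =ᶠ[𝓝 t] A := by
  obtain ⟨r, hr, hball⟩ := Metric.eventually_nhds_iff_ball.1 h
  have ht : t ∈ Metric.ball t r := Metric.mem_ball_self hr
  have hpre : IsPreconnected (Metric.ball t r) := (convex_ball t r).isPreconnected
  have hd : ∀ s ∈ Metric.ball t r, DifferentiableAt ℝ c s := fun s hs =>
    (hball s hs).1.differentiableAt (by simp)
  have hdd : ∀ s ∈ Metric.ball t r, DifferentiableAt ℝ (deriv c) s := fun s hs =>
    (ContDiffAt.derivWithin (m := 1) (hball s hs).1 (by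
      exact WithTop.coe_le_coe.2 le_top)).differentiableAt (by simp)
  have hconst : ∀ s ∈ Metric.ball t r, deriv c s = deriv c t := fun s hs =>
    Metric.isOpen_ball.is_const_of_deriv_eq_zero hpre
      (fun u hu => (hdd u hu).differentiableWithinAt) (fun u hu => (hball u hu).2) hs ht
  set d := deriv c t
  have hline : ∀ s, HasDerivAt (fun s : ℝ => s • d + (c t - t • d)) d s := fun s => by
    simpa using ((hasDerivAt_id s).smul_const d).add_const (c t - t • d)
  refine ⟨AffineMap.lineMap (c t - t • d) (d + (c t - t • d)), ?_⟩
  filter_upwards [Metric.ball_mem_nhds t hr] with s hs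
  rw [AffineMap.lineMap_apply_module', add_sub_cancel_right]
  refine Metric.isOpen_ball.eqOn_of_deriv_eq hpre
    (fun u hu => (hd u hu).differentiableWithinAt)
    (fun u _ => (hline u).differentiableAt.differentiableWithinAt)
    (fun u hu => by rw [hconst u hu, (hline u).deriv]) ht (by simp) hs

/-- Trades the differential equation for local affineness, to which unique continuation applies. -/
theorem isGeodesicOn_iff [HasGroupoid M (affineGroupoid m)] {γ : ℝ → M} {s : Set ℝ}
    (hs : IsOpen s) : IsGeodesicOn m γ s ↔ ∀ t ∈ s, AffineAt m γ t := by
  constructor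
  · intro h t ht
    have hφ := (affineGroupoid m).chart_mem_maximalAtlas (M := M) (γ t)
    have hm : γ t ∈ (chartAt (RSpace m) (γ t)).source := mem_chart_source _ _
    generalize chartAt (RSpace m) (γ t) = φ at hφ hm
    have hsrc : ∀ᶠ u in 𝓝 t, γ u ∈ φ.source :=
      (h.continuousOn.continuousAt (hs.mem_nhds ht)).eventually (φ.open_source.mem_nhds hm)
    obtain ⟨A, hA⟩ : ∃ A : ℝ →ᵃ[ℝ] RSpace m, φ ∘ γ =ᶠ[𝓝 t] A := by
      apply exists_affineMap_eq_of_deriv_deriv_eq_zero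
      filter_upwards [hsrc, hs.mem_nhds ht] with u hu hus
      exact ⟨h.contDiffAt φ hφ u hus hu, h.geodesic_eq φ hφ u hus hu⟩
    refine ⟨φ, hφ, A, ?_, ?_⟩
    · rw [← hA.self_of_nhds]
      exact φ.map_source hm
    · filter_upwards [hsrc, hA] with u h1 h2
      rw [Function.comp_apply, ← h2, Function.comp_apply, φ.left_inv h1]
  · intro h
    have key : ∀ (A : ℝ →ᵃ[ℝ] RSpace m), ∀ t, HasDerivAt A (A.linear 1) t := fun A t =>
      A.hasDerivAt
    refine ⟨fun t ht => (h t ht).continuousAt.continuousWithinAt, fun φ hφ t ht hm => ?_,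
      fun φ hφ t ht hm => ?_⟩
    · obtain ⟨A, hA⟩ := (h t ht).exists_chart_eq hφ hm
      exact ContDiffAt.congr_of_eventuallyEq (ContinuousAffineMap.contDiff
        ⟨A, A.continuous_of_finiteDimensional⟩).contDiffAt hA
    · obtain ⟨A, hA⟩ := (h t ht).exists_chart_eq hφ hm
      rw [hA.deriv.deriv_eq, show deriv A = fun _ => A.linear 1 from
        funext fun u => (key A u).deriv, deriv_const]

end Basic

/-! ### The exponential map and its uniqueness up to affine transformations. -/

section Exp

variable {m : ℕ} {M : Type*} [TopologicalSpace M] [ChartedSpace (RSpace m) M]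
  [HasGroupoid M (affineGroupoid m)]

theorem IsCompleteAffine.exists_geodesic (hM : IsCompleteAffine m M)
    {φ : OpenPartialHomeomorph M (RSpace m)} (hφ : φ ∈ (affineGroupoid m).maximalAtlas M)
    {x₀ : RSpace m} (hx₀ : x₀ ∈ φ.target) (x : RSpace m) :
    ∃ γ : ℝ → M, (∀ t, AffineAt m γ t) ∧
      γ =ᶠ[𝓝 0] φ.symm ∘ AffineMap.lineMap (k := ℝ) x₀ x := by
  have hc : Continuous (AffineMap.lineMap (k := ℝ) x₀ x) := AffineMap.lineMap_continuous
  have h0 : AffineMap.lineMap x₀ x (0 : ℝ) ∈ φ.target := by simpa using hx₀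
  obtain ⟨r, hr, hball⟩ := Metric.eventually_nhds_iff_ball.1
    (hc.continuousAt.eventually (φ.open_target.mem_nhds h0))
  obtain ⟨γ, hγ, heq⟩ := hM (φ.symm ∘ AffineMap.lineMap (k := ℝ) x₀ x) (Metric.ball 0 r)
    Metric.isOpen_ball (convex_ball 0 r).ordConnected ⟨0, Metric.mem_ball_self hr⟩
    ((isGeodesicOn_iff Metric.isOpen_ball).2 fun t ht =>
      ⟨φ, hφ, AffineMap.lineMap (k := ℝ) x₀ x, hball t ht, EventuallyEq.rfl⟩)
  exact ⟨γ, fun t => (isGeodesicOn_iff isOpen_univ).1 hγ t (mem_univ t),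
    heq.eventuallyEq_of_mem (Metric.ball_mem_nhds 0 hr)⟩

variable [T2Space M]

/-- A geodesic that agrees near `s` with a straight segment read in a chart does so at `t` if the
segment stays in a convex subset of the target of the chart. -/
theorem AffineAt.eq_symm_of_convex {γ : ℝ → M} (hγ : ∀ t, AffineAt m γ t)
    {ψ : OpenPartialHomeomorph M (RSpace m)} (hψ : ψ ∈ (affineGroupoid m).maximalAtlas M)
    {K : Set (RSpace m)} (hK : Convex ℝ K) (hKψ : K ⊆ ψ.target)
    {A : ℝ →ᵃ[ℝ] RSpace m} {s t : ℝ} (hs : A s ∈ K) (ht : A t ∈ K)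
    (h : γ =ᶠ[𝓝 s] ψ.symm ∘ A) : γ t = ψ.symm (A t) :=
  AffineAt.eqOn (hK.affine_preimage A).isPreconnected (fun u _ => hγ u)
    (fun _ hu => ⟨ψ, hψ, A, hKψ hu, EventuallyEq.rfl⟩) hs h ht

/-- The exponential map: a complete affine manifold admits a map from `ℝ^m` which is everywhere
locally an affine isomorphism and which near `x₀` is the inverse of a given chart. -/
theorem IsCompleteAffine.exists_exp (hM : IsCompleteAffine m M)
    {φ : OpenPartialHomeomorph M (RSpace m)} (hφ : φ ∈ (affineGroupoid m).maximalAtlas M)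
    {x₀ : RSpace m} (hx₀ : x₀ ∈ φ.target) :
    ∃ f : RSpace m → M, (∀ x, AffineEtaleAt m f x) ∧ f =ᶠ[𝓝 x₀] φ.symm := by
  choose γ hγ hγ0 using fun x => hM.exists_geodesic hφ hx₀ x
  have hline : ∀ x : RSpace m, Continuous (AffineMap.lineMap (k := ℝ) x₀ x) :=
    fun x => AffineMap.lineMap_continuous
  -- Homogeneity of geodesics: rescaling the initial velocity by `s` rescales time by `s`.
  have hexp : ∀ x (s : ℝ), γ (AffineMap.lineMap x₀ x s) 1 = γ x s := by
    intro x s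
    have hmul : Tendsto (fun t : ℝ => AffineMap.lineMap (k := ℝ) 0 s t) (𝓝 0) (𝓝 0) := by
      simpa using (AffineMap.lineMap_continuous (R := ℝ) (p := (0 : ℝ)) (q := s)).tendsto 0
    have key : EqOn (γ (AffineMap.lineMap x₀ x s)) (γ x ∘ AffineMap.lineMap (k := ℝ) 0 s) univ := by
      refine AffineAt.eqOn isPreconnected_univ (fun t _ => hγ _ t) (fun t _ => (hγ x _).comp)
        (mem_univ 0) ((hγ0 _).trans ?_)
      filter_upwards [hmul.eventually (hγ0 x)] with t ht
      simp only [Function.comp_apply] at ht ⊢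
      rw [ht]
      simp [AffineMap.lineMap_apply_module', mul_smul]
    simpa using key (mem_univ 1)
  set f : RSpace m → M := fun x => γ x 1 with hf
  have hfγ : ∀ x, f ∘ AffineMap.lineMap (k := ℝ) x₀ x = γ x := fun x => funext fun s => hexp x s
  have hf0 : f =ᶠ[𝓝 x₀] φ.symm := by
    obtain ⟨r, hr, hball⟩ := Metric.isOpen_iff.1 φ.open_target x₀ hx₀
    filter_upwards [Metric.ball_mem_nhds x₀ hr] with y hy
    simpa using AffineAt.eq_symm_of_convex (hγ y) hφ (convex_ball x₀ r) hball (s := 0) (t := 1)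
      (by simpa using hr) (by simpa using hy) (hγ0 y)
  have hE0 : AffineEtaleAt m f x₀ := ⟨φ, hφ, 1, hx₀, hf0⟩
  refine ⟨f, fun x => ?_, hf0⟩
  -- Étaleness is propagated along the ray from `x₀` through `x`; it is an open condition, so the
  -- limit parameters `T` are what matters.
  have hsub : (univ : Set ℝ) ⊆ {t : ℝ | AffineEtaleAt m f (AffineMap.lineMap x₀ x t)} := by
    refine isPreconnected_univ.subset_of_closure_inter_subset ?_ ⟨0, mem_univ _, by simpa using hE0⟩
      ?_
    · exact isOpen_iff_eventually.2 fun t ht => (hline x).continuousAt.eventually ht.eventually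
    rintro T ⟨hT, -⟩
    rcases eq_or_ne T 0 with rfl | hT0
    · simpa using hE0
    have hψ := (affineGroupoid m).chart_mem_maximalAtlas (M := M) (γ x T)
    have hm : γ x T ∈ (chartAt (RSpace m) (γ x T)).source := mem_chart_source _ _
    generalize chartAt (RSpace m) (γ x T) = ψ at hψ hm
    obtain ⟨A, hA⟩ := (hγ x T).exists_chart_eq hψ hm
    have hAT : A T ∈ ψ.target := by
      rw [← hA.self_of_nhds]
      exact ψ.map_source hm
    obtain ⟨r, hr, hball⟩ := Metric.isOpen_iff.1 ψ.open_target (A T) hAT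
    have hKo : IsOpen (Metric.ball (A T) r) := Metric.isOpen_ball
    have hK := convex_ball (A T) r
    have hTK : A T ∈ Metric.ball (A T) r := Metric.mem_ball_self hr
    generalize Metric.ball (A T) r = K at hball hKo hK hTK
    -- `f` is étale at parameter `S`, chosen so close to `T` that the geodesic has both values in
    -- the convex set `K` of the chart `ψ`.
    obtain ⟨S, hS, hSA, hSK, hSsrc⟩ := ((mem_closure_iff_frequently.1 hT).and_eventually
      (hA.eventually_nhds.and ((A.continuous_of_finiteDimensional.continuousAt.eventually
        (hKo.mem_nhds hTK)).and ((hγ x T).eventually_source hm)))).exists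
    have hSsrc' : f (AffineMap.lineMap x₀ x S) ∈ ψ.source := by rwa [← hfγ] at hSsrc
    obtain ⟨B, hB⟩ := hS.exists_chart_eq hψ hSsrc'
    have hBA : B.toAffineMap.comp (AffineMap.lineMap x₀ x) = A := by
      refine AffineMap.eq_of_eventuallyEq (x := S) ?_
      filter_upwards [(hline x).continuousAt.eventually hB, hSA] with t h1 h2
      rw [← h2, ← hfγ]
      exact h1.symm
    have hBt : ∀ t, B (AffineMap.lineMap x₀ x t) = A t := fun t => congrArg (fun C => C t) hBA
    have hcy : ∀ t : ℝ, Continuous fun y : RSpace m => AffineMap.lineMap (k := ℝ) x₀ y t := by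
      intro t
      simp only [AffineMap.lineMap_apply_module']
      fun_prop
    have hfB := hS.affineAt.eventuallyEq_symm hSsrc' hB
    -- For `y` near `x`, the segment read through `B` has its points at `S` and `T` in `K`, so
    -- convexity carries the chart expression `B` of `f` from `S` to `T`.
    have hev : ∀ᶠ y in 𝓝 x, f (AffineMap.lineMap x₀ y T) = ψ.symm (B (AffineMap.lineMap x₀ y T)) := by
      filter_upwards [(hcy S).continuousAt.eventually hfB.eventually_nhds,
        (B.continuous.comp (hcy S)).continuousAt.eventually
          (hKo.mem_nhds (show B (AffineMap.lineMap x₀ x S) ∈ K from (hBt S).symm ▸ hSK)),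
        (B.continuous.comp (hcy T)).continuousAt.eventually
          (hKo.mem_nhds (show B (AffineMap.lineMap x₀ x T) ∈ K from (hBt T).symm ▸ hTK))]
        with y h1 h2 h3
      refine (hexp y T).trans (AffineAt.eq_symm_of_convex (hγ y) hψ hK hball
        (A := B.toAffineMap.comp (AffineMap.lineMap x₀ y)) (s := S) h2 h3 ?_)
      rw [← hfγ]
      exact (hline y).continuousAt.eventually h1
    refine ⟨ψ, hψ, B, (hBt T).symm ▸ hAT, ?_⟩
    -- Since `T ≠ 0`, points near the one at parameter `T` lie at parameter `T` on rays through
    -- points near `x`.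
    have hinv : Tendsto (fun z : RSpace m => AffineMap.lineMap (k := ℝ) x₀ z T⁻¹)
        (𝓝 (AffineMap.lineMap x₀ x T)) (𝓝 x) := by
      have := (hcy T⁻¹).tendsto (AffineMap.lineMap x₀ x T)
      simpa [AffineMap.lineMap_apply_module', smul_smul, hT0] using this
    filter_upwards [hinv.eventually hev] with z hz
    simpa [AffineMap.lineMap_apply_module', smul_smul, hT0] using hz
  simpa using hsub (mem_univ 1)

/-- Two everywhere étale affine maps that meet differ by an affine transformation. -/
theorem AffineEtaleAt.exists_comp_aff_eq {f h : RSpace m → M} (hf : ∀ x, AffineEtaleAt m f x)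
    (hh : ∀ x, AffineEtaleAt m h x) {x y : RSpace m} (hxy : f x = h y) :
    ∃ g : Aff m, g x = y ∧ f = h ∘ g := by
  have hφ := (affineGroupoid m).chart_mem_maximalAtlas (M := M) (f x)
  have hm : f x ∈ (chartAt (RSpace m) (f x)).source := mem_chart_source _ _
  generalize chartAt (RSpace m) (f x) = φ at hφ hm
  obtain ⟨A, hA⟩ := (hf x).exists_chart_eq hφ hm
  obtain ⟨B, hB⟩ := (hh y).exists_chart_eq hφ (hxy ▸ hm)
  have hg : (B⁻¹ * A) x = y := by
    change B.symm (A x) = y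
    rw [B.symm_apply_eq, ← hA.self_of_nhds, ← hB.self_of_nhds]
    simp [hxy]
  refine ⟨B⁻¹ * A, hg, funext fun z => ?_⟩
  refine AffineAt.eqOn isPreconnected_univ (fun u _ => (hf u).affineAt)
    (fun u _ => ((hh _).comp_aff (B⁻¹ * A)).affineAt) (mem_univ x) ?_ (mem_univ z)
  have hc : Tendsto (B⁻¹ * A) (𝓝 x) (𝓝 y) := by
    simpa only [hg] using (Aff.continuous (B⁻¹ * A)).tendsto x
  filter_upwards [(hf x).affineAt.eventuallyEq_symm hm hA,
    hc.eventually ((hh y).affineAt.eventuallyEq_symm (hxy ▸ hm) hB)] with u h1 h2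
  simp only [Function.comp_apply] at h1 h2 ⊢
  rw [h1, h2]
  exact congrArg φ.symm (B.apply_symm_apply (A u)).symm

end Exp

/-! ### The deck group and the quotient by it. -/

section Developing

variable {m : ℕ} {M : Type*} [TopologicalSpace M]

/-- The affine transformations that preserve `f`. -/
def affDeck (f : RSpace m → M) : Subgroup (Aff m) where
  carrier := {g | ∀ x, f (g x) = f x}
  one_mem' _ := rfl
  mul_mem' {a b} ha hb x := (ha (b x)).trans (hb x)
  inv_mem' {a} ha x := by
    have h : a (a⁻¹ x) = x := a.apply_symm_apply x
    rw [← ha (a⁻¹ x), h]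

/-- Local injectivity of `f` spreads the agreement at `x` to a neighbourhood, which determines an
affine map. This gives freeness, discreteness and disjointness of translates. -/
theorem eq_of_mem_affDeck_of_apply_eq {f : RSpace m → M} (hf : IsLocalHomeomorph f) {g h : Aff m}
    (hg : g ∈ affDeck f) (hh : h ∈ affDeck f) {x : RSpace m} (hx : g x = h x) : g = h := by
  obtain ⟨e, hxe, rfl⟩ := hf (g x)
  have h1 := g.continuous.continuousAt.eventually (e.open_source.mem_nhds hxe)
  have h2 := h.continuous.continuousAt.eventually (e.open_source.mem_nhds (hx ▸ hxe))
  have : g.toAffineMap = h.toAffineMap := AffineMap.eq_of_eventuallyEq (x := x) <| by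
    filter_upwards [h1, h2] with y h1 h2
    exact e.injOn h1 h2 ((hg y).trans (hh y).symm)
  exact AffineEquiv.toAffineMap_injective this

theorem Aff.continuous_eval (x : RSpace m) : Continuous fun g : Aff m => g x := by
  have h : Continuous fun g : Aff m =>
      (LinearMap.toContinuousLinearMap (g.linear : RSpace m →ₗ[ℝ] RSpace m), g 0) :=
    continuous_induced_dom
  have h' := (h.fst.clm_apply (continuous_const (y := x))).add h.snd
  refine h'.congr fun g => ?_
  simpa using (g.map_vadd 0 x).symm

theorem isDiscrete_affDeck {f : RSpace m → M} (hf : IsLocalHomeomorph f) :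
    IsDiscrete (affDeck f : Set (Aff m)) := by
  refine IsDiscrete.of_nhdsWithin fun g hg => ?_
  obtain ⟨e, hxe, he⟩ := hf (g 0)
  have hev := (Aff.continuous_eval (0 : RSpace m)).continuousAt.eventually
    (e.open_source.mem_nhds hxe)
  rw [le_pure_iff]
  filter_upwards [hev.filter_mono nhdsWithin_le_nhds, self_mem_nhdsWithin] with h h1 h2
  refine eq_of_mem_affDeck_of_apply_eq hf h2 hg (x := 0) (e.injOn h1 hxe ?_)
  rw [← he]
  exact (h2 0).trans (hg 0).symm

theorem affProj_eq_iff {Γ : Subgroup (Aff m)} {x y : RSpace m} :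
    affProj Γ x = affProj Γ y ↔ ∃ g ∈ Γ, g y = x := by
  rw [affProj, Quotient.eq]
  exact ⟨fun ⟨g, hg⟩ => ⟨g, g.2, hg⟩, fun ⟨g, hg, h⟩ => ⟨⟨g, hg⟩, h⟩⟩

theorem isQuotientCoveringMap_affDeck {f : RSpace m → M} (hf : IsLocalHomeomorph f)
    (hs : Function.Surjective f) (htr : ∀ x y, f x = f y → ∃ g ∈ affDeck f, g y = x) :
    IsQuotientCoveringMap f (affDeck f) where
  toIsQuotientMap := hf.isOpenMap.isQuotientMap hf.continuous hs
  continuous_const_smul g := Aff.continuous g.1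
  apply_eq_iff_mem_orbit {x y} := by
    refine ⟨fun h => ?_, fun ⟨g, hg⟩ => ?_⟩
    · obtain ⟨g, hg, h⟩ := htr x y h
      exact ⟨⟨g, hg⟩, h⟩
    · rw [← hg]
      exact g.2 y
  disjoint x := by
    obtain ⟨e, hxe, he⟩ := hf x
    refine ⟨e.source, e.open_source.mem_nhds hxe, ?_⟩
    rintro ⟨g, hg⟩ ⟨-, ⟨y, hy, rfl⟩, hgy⟩
    refine Subtype.ext (eq_of_mem_affDeck_of_apply_eq hf hg (one_mem _) (x := y) ?_)
    refine e.injOn hgy hy ?_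
    rw [← he]
    exact hg y

/-- The homeomorphism `ℝ^m / Γ → M` induced by `f`, where `Γ` is the group of affine
transformations preserving `f`. -/
theorem exists_homeomorph_affQuotient {f : RSpace m → M} (hf : IsLocalHomeomorph f)
    (hs : Function.Surjective f) (htr : ∀ x y, f x = f y → ∃ g ∈ affDeck f, g y = x) :
    ∃ Φ : AffQuotient (affDeck f) ≃ₜ M, ∀ x, Φ (affProj (affDeck f) x) = f x := by
  let F : AffQuotient (affDeck f) → M :=
    Quotient.lift f fun x y ⟨g, hg⟩ => by rw [← hg]; exact g.2 y
  have hF : ∀ x, F (affProj (affDeck f) x) = f x := fun _ => rfl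
  have hc : Continuous F := hf.continuous.quotient_lift _
  have hFb : Function.Bijective F := by
    refine ⟨fun a b => ?_, fun q => ?_⟩
    · induction a using Quotient.inductionOn
      induction b using Quotient.inductionOn
      exact fun h => affProj_eq_iff.2 (htr _ _ h)
    · obtain ⟨x, hx⟩ := hs q
      exact ⟨affProj _ x, hx⟩
  have hFo : IsOpenMap F := fun U hU => by
    have : F '' U = f '' (affProj (affDeck f) ⁻¹' U) := by
      ext q
      constructor
      · rintro ⟨a, ha, rfl⟩
        induction a using Quotient.inductionOn with | _ x => exact ⟨x, ha, rfl⟩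
      · rintro ⟨x, hx, rfl⟩
        exact ⟨_, hx, rfl⟩
    rw [this]
    exact hf.isOpenMap _ (hU.preimage continuous_quotient_mk')
  exact ⟨(Equiv.ofBijective F hFb).toHomeomorphOfContinuousOpen hc hFo, hF⟩

theorem affQuotientChartedSpace_symm_apply {Γ : Subgroup (Aff m)}
    (hΓ : IsLocalHomeomorph (affProj Γ)) {c : OpenPartialHomeomorph (AffQuotient Γ) (RSpace m)}
    (hc : c ∈ (affQuotientChartedSpace Γ hΓ).atlas) (x : RSpace m) :
    c.symm x = affProj Γ x := by
  obtain ⟨q, rfl⟩ := hc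
  simp only [chartAt_self_eq, OpenPartialHomeomorph.trans_refl]
  exact congrFun (hΓ.localInverseAt_symm _) x

variable [ChartedSpace (RSpace m) M]

theorem AffineEtaleAt.isLocalHomeomorph {f : RSpace m → M} (hf : ∀ x, AffineEtaleAt m f x) :
    IsLocalHomeomorph f := by
  refine IsLocalHomeomorph.mk f fun x => ?_
  obtain ⟨φ, -, A, hA, h⟩ := hf x
  obtain ⟨U, hU, hUo, hxU⟩ := eventually_nhds_iff.1 h
  let e : OpenPartialHomeomorph (RSpace m) M :=
    (A.toContinuousAffineEquiv.toHomeomorph.toOpenPartialHomeomorph ≫ₕ φ.symm).restrOpen U hUo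
  have he : ∀ y, e y = φ.symm (A y) := fun _ => rfl
  have hes : e.source = A ⁻¹' φ.target ∩ U := by
    simp only [e, OpenPartialHomeomorph.restrOpen_source, OpenPartialHomeomorph.trans_source,
      Homeomorph.toOpenPartialHomeomorph_source, univ_inter]
    rfl
  exact ⟨e, hes ▸ ⟨hA, hxU⟩, fun y hy => (hU y (hes ▸ hy).2).trans (he y).symm⟩

/-- A complete connected affine manifold is covered by any everywhere étale affine map. -/
theorem AffineEtaleAt.surjective [T2Space M] [ConnectedSpace M] [HasGroupoid M (affineGroupoid m)]
    (hM : IsCompleteAffine m M) {f : RSpace m → M} (hf : ∀ x, AffineEtaleAt m f x) :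
    Function.Surjective f := by
  rw [← range_eq_univ]
  refine IsClopen.eq_univ ⟨?_, (isLocalHomeomorph hf).isOpenMap.isOpen_range⟩ (range_nonempty f)
  refine isClosed_of_closure_subset fun q hq => ?_
  have hφ := (affineGroupoid m).chart_mem_maximalAtlas (M := M) q
  have hm : q ∈ (chartAt (RSpace m) q).source := mem_chart_source _ _
  generalize chartAt (RSpace m) q = φ at hφ hm
  -- The exponential map at `q` has open image, which therefore meets that of `f`; then `h = f ∘ g`
  -- puts `q` in the range of `f`.
  obtain ⟨h, hh, hhφ⟩ := hM.exists_exp hφ (φ.map_source hm)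
  have hhq : h (φ q) = q := by rw [hhφ.self_of_nhds, φ.left_inv hm]
  have hr : range h ∈ 𝓝 q :=
    (isLocalHomeomorph hh).isOpenMap.isOpen_range.mem_nhds ⟨_, hhq⟩
  obtain ⟨-, ⟨y, rfl⟩, ⟨x, hxy⟩⟩ := mem_closure_iff_nhds.1 hq _ hr
  obtain ⟨g, -, hg⟩ := exists_comp_aff_eq hh hf hxy.symm
  exact ⟨g (φ q), (congrFun hg (φ q)).symm.trans hhq⟩

/-! ### Affine diffeomorphisms from the quotient, and the converse. -/

variable [HasGroupoid M (affineGroupoid m)]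

/-- A homeomorphism `ℝ^m / Γ → M` whose composition with the projection is étale affine is an
affine diffeomorphism. -/
def structomorphOfAffineEtale {Γ : Subgroup (Aff m)} (hΓ : IsLocalHomeomorph (affProj Γ))
    (Φ : AffQuotient Γ ≃ₜ M) (h : ∀ x, AffineEtaleAt m (fun x => Φ (affProj Γ x)) x) :
    letI : ChartedSpace (RSpace m) (AffQuotient Γ) := affQuotientChartedSpace Γ hΓ
    Structomorph (affineGroupoid m) (AffQuotient Γ) M :=
  letI : ChartedSpace (RSpace m) (AffQuotient Γ) := affQuotientChartedSpace Γ hΓ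
  { Φ with
    mem_groupoid := fun c c' hc hc' => by
      refine mem_affineGroupoid_iff.2 fun x hx => ?_
      have hsymm := affQuotientChartedSpace_symm_apply hΓ hc
      have hx' : Φ (affProj Γ x) ∈ c'.source := by
        rw [← hsymm]
        simp only [OpenPartialHomeomorph.trans_source, mem_inter_iff, mem_preimage] at hx
        exact hx.2.2
      obtain ⟨A, hA⟩ := (h x).exists_chart_eq
        ((affineGroupoid m).subset_maximalAtlas hc') hx'
      refine ⟨A, EventuallyEq.trans ?_ hA⟩
      refine Eventually.of_forall fun y => ?_
      exact congrArg (fun q => c' (Φ q)) (hsymm y) }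

theorem Structomorph.affineEtaleAt {Γ : Subgroup (Aff m)} (hΓ : IsLocalHomeomorph (affProj Γ)) :
    letI : ChartedSpace (RSpace m) (AffQuotient Γ) := affQuotientChartedSpace Γ hΓ
    ∀ (Φ : Structomorph (affineGroupoid m) (AffQuotient Γ) M) (x : RSpace m),
      AffineEtaleAt m (fun x => Φ.toHomeomorph (affProj Γ x)) x := by
  let : ChartedSpace (RSpace m) (AffQuotient Γ) := affQuotientChartedSpace Γ hΓ
  intro Φ x
  set f : RSpace m → M := fun x => Φ.toHomeomorph (affProj Γ x) with hf
  have hfc : Continuous f := Φ.toHomeomorph.continuous.comp continuous_quotient_mk'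
  have hc := chart_mem_atlas (RSpace m) (affProj Γ x)
  have hm : affProj Γ x ∈ (chartAt (RSpace m) (affProj Γ x)).source := mem_chart_source _ _
  generalize chartAt (RSpace m) (affProj Γ x) = c at hc hm
  have hsymm := affQuotientChartedSpace_symm_apply hΓ hc
  have hy : affProj Γ (c (affProj Γ x)) = affProj Γ x := by rw [← hsymm, c.left_inv hm]
  -- The chart at the class of `x` may return another point of the orbit; an element of `Γ` moves
  -- `x` there without changing `f`.
  obtain ⟨g, hg, hgx⟩ := affProj_eq_iff.1 hy
  have hfg : f ∘ g = f := funext fun z => congrArg Φ.toHomeomorph (affProj_eq_iff.2 ⟨g, hg, rfl⟩)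
  rw [← hfg]
  refine AffineEtaleAt.comp_aff g ?_
  rw [hgx]
  set y := c (affProj Γ x) with hydef
  have hψ := chart_mem_atlas (RSpace m) (f y)
  have hψm : f y ∈ (chartAt (RSpace m) (f y)).source := mem_chart_source _ _
  generalize chartAt (RSpace m) (f y) = ψ at hψ hψm
  obtain ⟨A, hA⟩ := mem_affineGroupoid_iff.1 (Φ.mem_groupoid c ψ hc hψ) y (by
    simp only [OpenPartialHomeomorph.trans_source, mem_inter_iff, mem_preimage]
    refine ⟨c.map_source hm, trivial, ?_⟩
    rw [hsymm]
    exact hψm)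
  have hA' : ψ ∘ f =ᶠ[𝓝 y] A := EventuallyEq.trans
    (Eventually.of_forall fun z => congrArg (fun q => ψ (Φ.toHomeomorph q)) (hsymm z).symm) hA
  refine ⟨ψ, (affineGroupoid m).subset_maximalAtlas hψ, A, ?_, ?_⟩
  · rw [← hA'.self_of_nhds]
    exact ψ.map_source hψm
  · filter_upwards [hfc.continuousAt.eventually (ψ.open_source.mem_nhds hψm), hA'] with z h1 h2
    rw [Function.comp_apply, ← h2, Function.comp_apply, ψ.left_inv h1]

/-- An affine manifold with a surjective étale affine map from `ℝ^m` is complete. -/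
theorem IsCompleteAffine.of_affineEtale [T2Space M] {f : RSpace m → M}
    (hf : ∀ x, AffineEtaleAt m f x) (hs : Function.Surjective f) : IsCompleteAffine m M := by
  rintro γ s hso hsc ⟨t₀, ht₀⟩ hγ
  rw [isGeodesicOn_iff hso] at hγ
  obtain ⟨x₀, hx₀⟩ := hs (γ t₀)
  have hφ := (affineGroupoid m).chart_mem_maximalAtlas (M := M) (γ t₀)
  have hm : γ t₀ ∈ (chartAt (RSpace m) (γ t₀)).source := mem_chart_source _ _
  generalize chartAt (RSpace m) (γ t₀) = φ at hφ hm
  obtain ⟨A, hA⟩ := (hf x₀).exists_chart_eq hφ (hx₀ ▸ hm)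
  obtain ⟨B, hB⟩ := (hγ t₀ ht₀).exists_chart_eq hφ hm
  have hfA := (hf x₀).affineAt.eventuallyEq_symm (hx₀ ▸ hm) hA
  have hγB := (hγ t₀ ht₀).eventuallyEq_symm hm hB
  -- The line through `x₀` lifting the germ of `γ` at `t₀`.
  let C : ℝ →ᵃ[ℝ] RSpace m := A.symm.toAffineMap.comp B
  have hAC : ∀ t, A (C t) = B t := fun t => A.apply_symm_apply (B t)
  have hC : C t₀ = x₀ := by
    apply A.injective
    rw [hAC, ← hA.self_of_nhds, ← hB.self_of_nhds, Function.comp_apply, Function.comp_apply, hx₀]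
  have hfC : ∀ t, AffineAt m (f ∘ C) t := fun t => (hf _).affineAt.comp
  refine ⟨f ∘ C, (isGeodesicOn_iff isOpen_univ).2 fun t _ => hfC t,
    AffineAt.eqOn hsc.isPreconnected (fun t _ => hfC t) hγ ht₀ ?_⟩
  have hCt : Tendsto C (𝓝 t₀) (𝓝 x₀) := by
    simpa only [hC] using C.continuous_of_finiteDimensional.tendsto t₀
  filter_upwards [hCt.eventually hfA, hγB] with t h1 h2
  rw [h2, Function.comp_apply, h1, Function.comp_apply, Function.comp_apply, hAC]

end Developing

theorem mainTheorem6 (m : ℕ) (M : Type*) [TopologicalSpace M] [T2Space M] [ConnectedSpace M]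
    [ChartedSpace (RSpace m) M] [HasGroupoid M (affineGroupoid m)] :
    IsCompleteAffine m M ↔
      ∃ Γ : Subgroup (Aff m), IsDiscrete (Γ : Set (Aff m)) ∧
        ∃ hΓ : IsLocalHomeomorph (affProj Γ),
          letI : ChartedSpace (RSpace m) (AffQuotient Γ) := affQuotientChartedSpace Γ hΓ
          ∃ Φ : Structomorph (affineGroupoid m) (AffQuotient Γ) M,
            IsUniversalCover (fun x : RSpace m => Φ.toHomeomorph (affProj Γ x)) := by
  constructor
  · intro hM
    obtain ⟨p⟩ := (inferInstance : Nonempty M)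
    obtain ⟨f, hf, -⟩ := hM.exists_exp ((affineGroupoid m).chart_mem_maximalAtlas p)
      (mem_chart_target (RSpace m) p)
    have hloc := AffineEtaleAt.isLocalHomeomorph hf
    have hsurj := AffineEtaleAt.surjective hM hf
    have htr : ∀ x y, f x = f y → ∃ g ∈ affDeck f, g y = x := fun x y hxy => by
      obtain ⟨g, hg, hfg⟩ := AffineEtaleAt.exists_comp_aff_eq hf hf hxy.symm
      exact ⟨g, fun z => (congrFun hfg z).symm, hg⟩
    obtain ⟨Φ, hΦ⟩ := exists_homeomorph_affQuotient hloc hsurj htr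
    have hΦf : (fun x => Φ (affProj (affDeck f) x)) = f := funext hΦ
    have hΓ : IsLocalHomeomorph (affProj (affDeck f)) := by
      have : affProj (affDeck f) = Φ.symm ∘ f := funext fun x => by simp [← hΦ]
      rw [this]
      exact Φ.symm.isLocalHomeomorph.comp hloc
    refine ⟨affDeck f, isDiscrete_affDeck hloc, hΓ,
      structomorphOfAffineEtale hΓ Φ (hΦf.symm ▸ hf), ?_⟩
    change IsUniversalCover (fun x => Φ (affProj (affDeck f) x))
    rw [hΦf]
    exact ⟨inferInstance, (isQuotientCoveringMap_affDeck hloc hsurj htr).isCoveringMap, hsurj⟩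
  · rintro ⟨Γ, -, hΓ, Φ, hΦ⟩
    exact IsCompleteAffine.of_affineEtale (Structomorph.affineEtaleAt hΓ Φ) hΦ.surjective
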